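/- Let $\mathbb F$ be a finite field, $I$ a finite index set, $\mathcal C\subseteq\mathbb F^I$ a linear code, and $\mathcal G$ a finite connected graph (loops and parallel edges are allowed). Then $\kappa_{\text{vc-path}}(\mathcal G)>0$ and $$\kappa(\mathcal C;\mathcal G)\;\ge\;\frac{\kappa_{\text{path}}(\mathcal C)}{\kappa_{\text{vc-path}}(\mathcal G)}\;\ge\;\frac{\kappa_{\text{path}}(\mathcal C)}{\kappa_{\text{path}}(\mathcal G)+1}.$$ Here the notation is as follows. *Realizations.* Let $\mathcal G=(V,E)$ be a connected graph, $\omega:I\to V$ a map, and $E(v)$ the set of edges incident with $v$. A graphical model on $(\mathcal G,\omega)$ consists of a finite-dimensional $\mathbb F$-vector space $\mathcal S_e$ for each $e\in E$ and a subspace $C_v\subseteq \mathbb F^{\omega^{-1}(v)}\oplus\bigoplus_{e\in E(v)}\mathcal S_e$ for each $v\in V$. Its full behavior $\mathfrak B$ is the set of all $((x_i)_{i\in I},(s_e)_{e\in E})$ in $\mathbb F^I\oplus\bigoplus_{e\in E}\mathcal S_e$ with $((x_i)_{i\in\omega^{-1}(v)},(s_e)_{e\in E(v)})\in C_v$ for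 every $v\in V$. The model is a realization of $\mathcal C$ if it is essential, i.e. $\mathfrak B$ projects onto every $C_v$ and onto every $\mathcal S_e$, and the projection of $\mathfrak B$ to $\mathbb F^I$ is $\mathcal C$. Its $\kappa$-complexity is $\max_{v\in V}\dim C_v$. The number $\kappa(\mathcal C;\mathcal G,\omega)$ is the least $\kappa$-complexity of a realization of $\mathcal C$ on $(\mathcal G,\omega)$, and $\kappa(\mathcal C;\mathcal G)=\min_{\omega:I\to V}\kappa(\mathcal C;\mathcal G,\omega)$. A path is a tree with exactly two leaves, and $\kappa_{\text{path}}(\mathcal C)=\min_P\kappa(\mathcal C;P)$ over all paths $P$. *Vertex-cut paths.* For $A\subseteq V$ let $N(A)$ be the set of vertices adjacent to some vertex of $A$. A family $(V_0,V_1,\dots,V_\delta)$ of pairwise disjoint, possibly empty sets with union $V$ is a star partition of $V$ if $N(V_i)\subseteq V_i\cup V_0$ for all $i\ge1$. A vertex-cut tree of $\mathcal G$ is a pair $(T,\beta)$ of a tree $T$ and a map $\beta:V(T)\to 2^V$ such that (1) $\bigcup_z\beta(z)=V$; (2) $\beta(x)\cap\beta(y)\subseteq\beta(z)$ whenever $z$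 lies on the path from $x$ to $y$ in $T$; (3) for each $z\in V(T)$, if $T_1,\dots,T_\delta$ are the components of $T-z$ and $V_i=\bigl(\bigcup_{x\in V(T_i)}\beta(x)\bigr)\setminus\beta(z)$, then $(\beta(z),V_1,\dots,V_\delta)$ is a star partition of $V$. The number $\kappa_{\text{vc-path}}(\mathcal G)$ is the least value of $\max_z|\beta(z)|$ over all vertex-cut trees $(T,\beta)$ of $\mathcal G$ in which $T$ is a path. *Pathwidth of a graph.* A path decomposition of $\mathcal G$ is a pair $(T,\beta)$, with $T$ a path and $\beta:V(T)\to2^V$, satisfying (1), (2) and: for any two adjacent vertices $u,v$ of $\mathcal G$ there is a $z$ with $\{u,v\}\subseteq\beta(z)$. The number $\kappa_{\text{path}}(\mathcal G)$ is the least value of $\max_z|\beta(z)|-1$ over all path decompositions of $\mathcal G$. -/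

import Mathlib

namespace CodesOnGraphs

universe u v

/-! ### Graphs

Graphs are Mathlib multigraphs (loops and parallel edges are permitted). -/

section Graphs

variable {V E W : Type*}

/-- A multigraph is connected if it has a vertex and any two of its vertices are joined by a walk. -/
def IsConnected (G : Graph V E) : Prop :=
  G.vertexSet.Nonempty ∧
    ∀ x ∈ G.vertexSet, ∀ y ∈ G.vertexSet, Relation.ReflTransGen G.Adj x y

/-- The neighbourhood `N(A)` of a set `A` of vertices: all vertices adjacent to a member of `A`. -/
def neighbors (G : Graph V E) (A : Set V) : Set V :=
  {u | ∃ x ∈ A, G.Adj x u}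

/-- `(V₀, (Vᵢ)ᵢ)` is a star partition of the vertex set of `G`: the (possibly empty) parts are
pairwise disjoint and cover the vertex set, and `N(Vᵢ) ⊆ Vᵢ ∪ V₀` for every `i`. -/
structure IsStarPartition {ι : Type*} (G : Graph V E) (V₀ : Set V) (P : ι → Set V) : Prop where
  disjoint_center : ∀ i, Disjoint V₀ (P i)
  pairwise_disjoint : Pairwise fun i j => Disjoint (P i) (P j)
  union_eq : V₀ ∪ ⋃ i, P i = G.vertexSet
  neighbors_subset : ∀ i, neighbors G (P i) ⊆ P i ∪ V₀

/-- The set `β(V(K)) \ β(z)`, where `K` is a connected component of `T - z`. -/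
def branch (T : SimpleGraph W) (β : W → Set V) (z : W)
    (K : (T.induce {x | x ≠ z}).ConnectedComponent) : Set V :=
  (⋃ x ∈ K.supp, β x.1) \ β z

/-- `(T, β)` is a vertex-cut tree of `G`. The components of `T - z`
are indexed by `(T.induce {x | x ≠ z}).ConnectedComponent`. -/
structure IsVertexCutTree (G : Graph V E) (T : SimpleGraph W) (β : W → Set V) : Prop where
  isTree : T.IsTree
  cover : ⋃ z, β z = G.vertexSet
  inter_subset : ∀ (x y z : W) (p : T.Walk x y), p.IsPath → z ∈ p.support → β x ∩ β y ⊆ β z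
  star : ∀ z, IsStarPartition G (β z) (branch T β z)

/-- `(T, β)` is a tree decomposition of the graph `G`. -/
structure IsTreeDecomposition (G : Graph V E) (T : SimpleGraph W) (β : W → Set V) : Prop where
  isTree : T.IsTree
  cover : ⋃ z, β z = G.vertexSet
  inter_subset : ∀ (x y z : W) (p : T.Walk x y), p.IsPath → z ∈ p.support → β x ∩ β y ⊆ β z
  edge : ∀ x y, G.Adj x y → ∃ z, {x, y} ⊆ β z

/-- The largest bag size `max_z |β(z)|`. -/
noncomputable def maxBag (β : W → Set V) : ℕ :=
  ⨆ z, (β z).ncard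

/-- The vc-pathwidth of `G`: the least vc-width `max_z |β(z)|` among its vertex-cut paths. A path is
a tree with exactly two leaves, that is, up to isomorphism, `SimpleGraph.pathGraph n`, `n ≥ 2`. -/
noncomputable def vcPathwidth (G : Graph V E) : ℕ :=
  sInf {w | ∃ n, 2 ≤ n ∧ ∃ β : Fin n → Set V,
    IsVertexCutTree G (SimpleGraph.pathGraph n) β ∧ w = maxBag β}

/-- The pathwidth of `G`: the least width `max_z |β(z)| - 1` among its path decompositions. (If `G`
has a vertex then some bag is non-empty, so the subtraction is not truncated.) -/
noncomputable def graphPathwidth (G : Graph V E) : ℕ :=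
  sInf {w | ∃ n, 2 ≤ n ∧ ∃ β : Fin n → Set V,
    IsTreeDecomposition G (SimpleGraph.pathGraph n) β ∧ w = maxBag β - 1}

end Graphs

/-! ### Graphical models and realizations of codes -/

section Models

variable {F : Type u} [Field F] {I : Type v} {V E : Type*}

/-- A graphical model over `F` extending the graph decomposition `(G, ω)` of the index set `I`:
a (finite-dimensional) state space for each edge, and for each vertex `x` a local constraint code,
a subspace of `F^(ω⁻¹(x)) ⊕ ⨁_{e ∈ E(x)} S_e`. The sum is written as a product: in the graphs
considered it is finite. -/
structure GraphicalModel (F : Type u) [Field F] {I : Type v} {V E : Type*} (G : Graph V E)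
    (ω : I → G.vertexSet) where
  State : G.edgeSet → Type (max u v)
  [addCommGroupState : ∀ e, AddCommGroup (State e)]
  [moduleState : ∀ e, Module F (State e)]
  [finiteState : ∀ e, FiniteDimensional F (State e)]
  constraint : ∀ x : G.vertexSet, Submodule F
    (({i : I // ω i = x} → F) × (∀ e : {e : G.edgeSet // G.Inc e.1 x.1}, State e.1))

attribute [instance] GraphicalModel.addCommGroupState GraphicalModel.moduleState
  GraphicalModel.finiteState

namespace GraphicalModel

variable {G : Graph V E} {ω : I → G.vertexSet}

/-- The restriction of a global configuration to the local configuration at the vertex `x`. -/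
def toLocal (Γ : GraphicalModel F G ω) (x : G.vertexSet) :
    ((I → F) × (∀ e, Γ.State e)) →ₗ[F]
      (({i : I // ω i = x} → F) × (∀ e : {e : G.edgeSet // G.Inc e.1 x.1}, Γ.State e.1)) :=
  LinearMap.prodMap (LinearMap.pi fun i => LinearMap.proj i.1)
    (LinearMap.pi fun e => LinearMap.proj e.1)

/-- The restriction of a global configuration to the state at the edge `e`. -/
def toState (Γ : GraphicalModel F G ω) (e : G.edgeSet) :
    ((I → F) × (∀ e, Γ.State e)) →ₗ[F] Γ.State e :=
  LinearMap.proj e ∘ₗ LinearMap.snd F (I → F) (∀ e, Γ.State e)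

/-- The full behavior: all global configurations that satisfy every local constraint. -/
def fullBehavior (Γ : GraphicalModel F G ω) : Submodule F ((I → F) × (∀ e, Γ.State e)) :=
  ⨅ x, (Γ.constraint x).comap (Γ.toLocal x)

/-- A model is essential if its full behavior projects onto every local constraint code and onto
every state space. -/
def IsEssential (Γ : GraphicalModel F G ω) : Prop :=
  (∀ x, Γ.fullBehavior.map (Γ.toLocal x) = Γ.constraint x) ∧
    ∀ e, Γ.fullBehavior.map (Γ.toState e) = ⊤

/-- `Γ` is a realization of the code `C`: it is essential, and its full behavior projects onto
`C` on the symbol coordinates. -/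
def IsRealization (Γ : GraphicalModel F G ω) (C : Submodule F (I → F)) : Prop :=
  Γ.IsEssential ∧ Γ.fullBehavior.map (LinearMap.fst F (I → F) (∀ e, Γ.State e)) = C

/-- The `κ`-complexity of a model: the largest dimension of a local constraint code. -/
noncomputable def complexity (Γ : GraphicalModel F G ω) : ℕ :=
  ⨆ x, Module.finrank F (Γ.constraint x)

end GraphicalModel

/-- `κ(C; G, ω)`: the least `κ`-complexity of a realization of `C` extending `(G, ω)`. -/
noncomputable def decompositionWidth (C : Submodule F (I → F)) (G : Graph V E)
    (ω : I → G.vertexSet) : ℕ :=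
  sInf {k | ∃ Γ : GraphicalModel F G ω, Γ.IsRealization C ∧ k = Γ.complexity}

/-- The `G`-width `κ(C; G)`: the least value of `κ(C; G, ω)` over all index mappings `ω`. -/
noncomputable def graphWidth (C : Submodule F (I → F)) (G : Graph V E) : ℕ :=
  sInf {k | ∃ ω : I → G.vertexSet, k = decompositionWidth C G ω}

/-- The pathwidth of the code `C`: the least value of `κ(C; P)` over all paths `P`. -/
noncomputable def codePathwidth (C : Submodule F (I → F)) : ℕ :=
  sInf {k | ∃ n, 2 ≤ n ∧ k = graphWidth C (Graph.ofSimpleGraph (SimpleGraph.pathGraph n))}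

end Models

end CodesOnGraphs

namespace CodesOnGraphs

universe u v w

/-! ### Vertex-cut paths and path decompositions. -/

section Graphs

variable {V E W : Type*}

/-! Take an optimal realization of the code on `G`, with full behavior `B`, and an optimal
vertex-cut path `β`. For each path vertex `z` let `K z` be the space of configurations in `B` that
vanish locally at every vertex of `β z`. The new model on the path has state space `B ⧸ (K x ⊔ K y)`
on the edge `xy`, and its local code at `z` is a quotient of `B ⧸ K z`. Since `B ⧸ K z` embeds in
the product of the old local codes over `β z`, its dimension is at most `|β z|` times the old
complexity. Multiplying out gives the first inequality (`codePathwidth_le_mul`).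

What needs proof is that the new model generates no extra codewords. Because `β z` separates the two
sides of `z`, a configuration in `K z` may be cut off outside the left side and stays in `B`
(`exists_cutoff`). So it splits into a part vanishing on all bags to the left and a part vanishing
on all bags to the right, which lets compatible local data be glued along the path
(`exists_glue_of_split`).

The second inequality holds because every path decomposition is a vertex-cut path
(`IsTreeDecomposition.isVertexCutTree`). -/

lemma isTree_pathGraph_two : (SimpleGraph.pathGraph 2).IsTree := by
  classical
  rw [SimpleGraph.pathGraph_two_eq_top, SimpleGraph.isTree_iff_connected_and_card]
  refine ⟨SimpleGraph.connected_top, ?_⟩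
  rw [Nat.card_eq_fintype_card, ← SimpleGraph.edgeFinset_card,
    SimpleGraph.card_edgeFinset_top_eq_card_choose_two]
  simp

lemma ncard_le_maxBag [Finite W] (β : W → Set V) (z : W) : (β z).ncard ≤ maxBag β :=
  le_ciSup (f := fun z => (β z).ncard) (Set.finite_range _).bddAbove z

lemma maxBag_pos [Finite V] [Finite W] {G : Graph V E} (hG : IsConnected G) {β : W → Set V}
    (hβ : ⋃ z, β z = G.vertexSet) : 0 < maxBag β := by
  obtain ⟨x, hx⟩ := hG.1
  rw [← hβ, Set.mem_iUnion] at hx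
  obtain ⟨z, hz⟩ := hx
  exact ((Set.ncard_pos (Set.toFinite _)).2 ⟨x, hz⟩).trans_le (ncard_le_maxBag β z)

/-- A single bag, repeated, is a path decomposition. -/
lemma isTreeDecomposition_const (G : Graph V E) :
    IsTreeDecomposition G (SimpleGraph.pathGraph 2) (fun _ => G.vertexSet) where
  isTree := isTree_pathGraph_two
  cover := Set.iUnion_const _
  inter_subset _ _ _ _ _ _ := Set.inter_subset_left
  edge x y h := ⟨0, by
    rintro z (rfl | rfl)
    exacts [h.left_mem, h.right_mem]⟩

/-- If `a` and `b` lie in different components of `T - z`, then every walk from `a` to `b` in `T`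
meets `z`. -/
lemma mem_support_of_not_reachable {T : SimpleGraph W} {z : W} {a b : {x | x ≠ z}}
    (h : ¬ (T.induce {x | x ≠ z}).Reachable a b) (p : T.Walk a.1 b.1) : z ∈ p.support := by
  by_contra hz
  exact h ⟨p.induce {x | x ≠ z} fun x hx hxz => hz (hxz ▸ hx)⟩

/-- A vertex outside `β z` has all its bags in one component of `T - z`, since a path between two
components passes through `z`. Adjacent vertices outside `β z` share a bag, hence a component. -/
lemma IsTreeDecomposition.isVertexCutTree {G : Graph V E} {T : SimpleGraph W} {β : W → Set V}
    (h : IsTreeDecomposition G T β) : IsVertexCutTree G T β where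
  isTree := h.isTree
  cover := h.cover
  inter_subset := h.inter_subset
  star z := by
    classical
    have hdisj : ∀ (a b : {x | x ≠ z}) (u : V), u ∈ β a.1 → u ∈ β b.1 → u ∉ β z →
        (T.induce {x | x ≠ z}).connectedComponentMk a =
          (T.induce {x | x ≠ z}).connectedComponentMk b := by
      intro a b u ha hb hu
      rw [SimpleGraph.ConnectedComponent.eq]
      by_contra hab
      obtain ⟨p, hp⟩ := (h.isTree.connected.preconnected a.1 b.1).exists_isPath
      exact hu (h.inter_subset _ _ _ p hp (mem_support_of_not_reachable hab p) ⟨ha, hb⟩)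
    have hmem : ∀ K u, u ∈ branch T β z K ↔
        (∃ a : {x | x ≠ z}, (T.induce {x | x ≠ z}).connectedComponentMk a = K ∧ u ∈ β a.1) ∧
          u ∉ β z := by
      intro K u
      simp [branch]
    refine ⟨fun K => ?_, fun K L hKL => ?_, ?_, fun K => ?_⟩
    · exact Set.disjoint_sdiff_right
    · refine Set.disjoint_left.2 ?_
      intro u hK hL
      rw [hmem] at hK hL
      obtain ⟨⟨a, rfl, ha⟩, hu⟩ := hK
      obtain ⟨⟨b, rfl, hb⟩, -⟩ := hL
      exact hKL (hdisj a b u ha hb hu)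
    · rw [← h.cover]
      ext u
      simp only [Set.mem_union, Set.mem_iUnion, hmem]
      constructor
      · rintro (hu | ⟨K, ⟨a, -, ha⟩, -⟩)
        exacts [⟨z, hu⟩, ⟨a.1, ha⟩]
      · rintro ⟨y, hy⟩
        by_cases hu : u ∈ β z
        · exact Or.inl hu
        · exact Or.inr ⟨_, ⟨⟨y, fun hyz => hu (hyz ▸ hy)⟩, rfl, hy⟩, hu⟩
    · rintro v ⟨u, hu, huv⟩
      by_cases hv : v ∈ β z
      · exact Or.inr hv
      rw [hmem] at hu
      obtain ⟨⟨a, rfl, ha⟩, huz⟩ := hu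
      obtain ⟨y, hy⟩ := h.edge u v huv
      have hyu : u ∈ β y := hy (by simp)
      have hyv : v ∈ β y := hy (by simp)
      have hyz : y ≠ z := fun hyz => hv (hyz ▸ hyv)
      left
      rw [hmem]
      exact ⟨⟨⟨y, hyz⟩, hdisj _ _ u hyu ha huz, hyv⟩, hv⟩

lemma exists_vertexCutPath (G : Graph V E) :
    ∃ n, 2 ≤ n ∧ ∃ β : Fin n → Set V,
      IsVertexCutTree G (SimpleGraph.pathGraph n) β ∧ vcPathwidth G = maxBag β :=
  Nat.sInf_mem (s := {w | ∃ n, 2 ≤ n ∧ ∃ β : Fin n → Set V,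
    IsVertexCutTree G (SimpleGraph.pathGraph n) β ∧ w = maxBag β})
    ⟨_, 2, le_rfl, _, (isTreeDecomposition_const G).isVertexCutTree, rfl⟩

lemma exists_pathDecomposition (G : Graph V E) :
    ∃ n, 2 ≤ n ∧ ∃ β : Fin n → Set V,
      IsTreeDecomposition G (SimpleGraph.pathGraph n) β ∧ graphPathwidth G = maxBag β - 1 :=
  Nat.sInf_mem (s := {w | ∃ n, 2 ≤ n ∧ ∃ β : Fin n → Set V,
    IsTreeDecomposition G (SimpleGraph.pathGraph n) β ∧ w = maxBag β - 1})
    ⟨_, 2, le_rfl, _, isTreeDecomposition_const G, rfl⟩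

lemma vcPathwidth_pos [Finite V] {G : Graph V E} (hG : IsConnected G) : 0 < vcPathwidth G := by
  obtain ⟨n, -, β, hβ, h⟩ := exists_vertexCutPath G
  rw [h]
  exact maxBag_pos hG hβ.cover

lemma vcPathwidth_le_graphPathwidth_add_one [Finite V] {G : Graph V E} (hG : IsConnected G) :
    vcPathwidth G ≤ graphPathwidth G + 1 := by
  obtain ⟨n, hn, β, hβ, h⟩ := exists_pathDecomposition G
  rw [h, Nat.sub_add_cancel (maxBag_pos hG hβ.cover)]
  exact Nat.sInf_le ⟨n, hn, β, hβ.isVertexCutTree, rfl⟩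

/-- Steps of a walk change the index by one, so a walk avoiding `z` cannot jump over it; each
component of the path minus `z` thus lies on one side of `z`. -/
lemma lt_iff_of_reachable_pathGraph_induce {n : ℕ} {z : Fin n} {a b : {x | x ≠ z}}
    (h : ((SimpleGraph.pathGraph n).induce {x | x ≠ z}).Reachable a b) : a.1 < z ↔ b.1 < z := by
  obtain ⟨p⟩ := h
  induction p with
  | nil => rfl
  | @cons a c b hac _ ih =>
    rw [← ih]
    have h1 : (SimpleGraph.pathGraph n).Adj a.1 c.1 := hac
    rw [SimpleGraph.pathGraph_adj] at h1
    have ha : a.1.val ≠ z.val := fun h => a.2 (Fin.ext h)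
    have hc : c.1.val ≠ z.val := fun h => c.2 (Fin.ext h)
    rw [Fin.lt_def, Fin.lt_def]
    omega


lemma IsVertexCutTree.inter_subset_of_between {G : Graph V E} {n : ℕ} {β : Fin n → Set V}
    (h : IsVertexCutTree G (SimpleGraph.pathGraph n) β) {x z y : Fin n} (hxz : x < z)
    (hzy : z ≤ y) : β x ∩ β y ⊆ β z := by
  rcases hzy.eq_or_lt with rfl | hzy
  · exact Set.inter_subset_right
  classical
  obtain ⟨p, hp⟩ := (h.isTree.connected.preconnected x y).exists_isPath
  refine h.inter_subset _ _ _ p hp (mem_support_of_not_reachable (a := ⟨x, hxz.ne⟩)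
    (b := ⟨y, hzy.ne'⟩) (fun hr => ?_) p)
  exact hzy.not_gt ((lt_iff_of_reachable_pathGraph_induce hr).1 hxz)

/-- In a vertex-cut path, the vertices to the left of a bag `β z` are separated by it from the
remaining ones. -/
lemma IsVertexCutTree.neighbors_left_subset {G : Graph V E} {n : ℕ} {β : Fin n → Set V}
    (h : IsVertexCutTree G (SimpleGraph.pathGraph n) β) (z : Fin n) :
    neighbors G ((⋃ y < z, β y) \ β z) ⊆ ((⋃ y < z, β y) \ β z) ∪ β z := by
  rintro v ⟨u, ⟨hu, huz⟩, huv⟩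
  simp only [Set.mem_iUnion] at hu
  obtain ⟨y, hyz, hy⟩ := hu
  let K := ((SimpleGraph.pathGraph n).induce {x | x ≠ z}).connectedComponentMk ⟨y, hyz.ne⟩
  have hK : u ∈ branch (SimpleGraph.pathGraph n) β z K := by
    refine ⟨?_, huz⟩
    simp only [Set.mem_iUnion]
    exact ⟨⟨y, hyz.ne⟩, rfl, hy⟩
  rcases (h.star z).neighbors_subset K ⟨u, hK, huv⟩ with hv | hv
  · refine Or.inl ⟨?_, hv.2⟩
    have hv1 := hv.1
    simp only [Set.mem_iUnion] at hv1 ⊢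
    obtain ⟨a, ha, hva⟩ := hv1
    refine ⟨a.1, ?_, hva⟩
    exact (lt_iff_of_reachable_pathGraph_induce
      (SimpleGraph.ConnectedComponent.eq.1 ha)).2 hyz
  · exact Or.inr hv

end Graphs

/-- Gluing along a path: if each `K z` splits into a part that vanishes to the left of `z` and one
that vanishes to the right, then families that are consistent on consecutive indices are locally
induced by a single vector. -/
lemma exists_glue_of_split {F B : Type*} [Ring F] [AddCommGroup B] [Module F B] {n : ℕ}
    (K : Fin n → Submodule F B)
    (hK : ∀ z, ∀ k ∈ K z, ∃ l r, l + r = k ∧ (∀ y, z ≤ y → l ∈ K y) ∧ ∀ y, y ≤ z → r ∈ K y)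
    (b : Fin n → B) (hb : ∀ x y : Fin n, x.val + 1 = y.val → b x - b y ∈ K x ⊔ K y) :
    ∃ c, ∀ z, c - b z ∈ K z := by
  have key : ∀ m : ℕ, ∃ c, ∀ z : Fin n, z.val < m → c - b z ∈ K z := by
    intro m
    induction m with
    | zero => exact ⟨0, fun z hz => absurd hz (Nat.not_lt_zero _)⟩
    | succ m ih =>
      obtain ⟨c, hc⟩ := ih
      by_cases hmn : m < n
      swap
      · exact ⟨c, fun z hz => hc z (by omega)⟩
      rcases Nat.eq_zero_or_pos m with rfl | hm
      · refine ⟨b ⟨0, hmn⟩, fun z hz => ?_⟩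
        obtain rfl : z = ⟨0, hmn⟩ := Fin.ext (by simpa using hz)
        simp
      let x : Fin n := ⟨m - 1, by omega⟩
      let y : Fin n := ⟨m, hmn⟩
      have hxm : x.val = m - 1 := rfl
      have hym : y.val = m := rfl
      -- The vector `c` already glues up to the predecessor `x` of `y`; write `c - b y = (c - b x) +
      -- (b x - b y)`.
      have hcy : c - b y ∈ K x ⊔ K y := by
        have := Submodule.add_mem _ (Submodule.mem_sup_left (T := K y) (hc x (by omega)))
          (hb x y (by omega))
        simpa using this
      obtain ⟨k, hk, k', hk', hkk⟩ := Submodule.mem_sup.1 hcy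
      obtain ⟨l, r, hlr, hl, hr⟩ := hK x k hk
      obtain ⟨l', r', hlr', hl', hr'⟩ := hK y k' hk'
      -- Subtracting `r + r'` is harmless at earlier indices, where both lie in `K z`; at `y` it
      -- leaves the error `l + l'`, which lies in `K y`.
      refine ⟨c - (r + r'), fun z hz => ?_⟩
      rcases Nat.lt_succ_iff_lt_or_eq.1 hz with hz | hz
      · have h1 := hr z (Fin.le_def.2 (by omega))
        have h2 := hr' z (Fin.le_def.2 (by omega))
        have := Submodule.sub_mem _ (hc z hz) (Submodule.add_mem _ h1 h2)
        rwa [sub_right_comm]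
      · obtain rfl : z = y := Fin.ext hz
        have h1 := hl y (Fin.le_def.2 (by omega))
        have h2 := hl' y le_rfl
        have h3 : c - (r + r') - b y = l + l' := by
          rw [sub_right_comm, ← hkk, ← hlr, ← hlr']
          abel
        rw [h3]
        exact Submodule.add_mem _ h1 h2
  obtain ⟨c, hc⟩ := key n
  exact ⟨c, fun z => hc z z.2⟩

/-! ### Models induced by a space of configurations. -/

section Models

variable {F : Type u} [Field F] {I : Type v} {V E : Type*} {G : Graph V E} {ω : I → G.vertexSet}

namespace GraphicalModel

lemma mem_fullBehavior {Γ : GraphicalModel F G ω} {k : (I → F) × (∀ e, Γ.State e)} :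
    k ∈ Γ.fullBehavior ↔ ∀ x, Γ.toLocal x k ∈ Γ.constraint x := by
  simp [fullBehavior]

lemma toLocal_eq_iff {Γ : GraphicalModel F G ω} {x : G.vertexSet}
    {k l : (I → F) × (∀ e, Γ.State e)} :
    Γ.toLocal x k = Γ.toLocal x l ↔
      (∀ i, ω i = x → k.1 i = l.1 i) ∧ ∀ e, G.Inc e.1 x.1 → k.2 e = l.2 e := by
  simp only [toLocal, Prod.ext_iff, funext_iff, Subtype.forall]
  rfl

/-- The model whose local constraint codes are the images of a space `B` of global configurations,
given by the symbols `f` and the states `q`. -/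
def induced {B : Type w} [AddCommGroup B] [Module F B] (ω : I → G.vertexSet)
    (f : B →ₗ[F] (I → F)) (S : G.edgeSet → Type (max u v)) [∀ e, AddCommGroup (S e)]
    [∀ e, Module F (S e)] [∀ e, FiniteDimensional F (S e)] (q : ∀ e, B →ₗ[F] S e) :
    GraphicalModel F G ω where
  State := S
  constraint x := LinearMap.range
    ((LinearMap.pi fun i : {i : I // ω i = x} => LinearMap.proj i.1 ∘ₗ f).prod
      (LinearMap.pi fun e : {e : G.edgeSet // G.Inc e.1 x.1} => q e.1))

section

variable {B : Type w} [AddCommGroup B] [Module F B] {f : B →ₗ[F] (I → F)}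
  {S : G.edgeSet → Type (max u v)} [∀ e, AddCommGroup (S e)] [∀ e, Module F (S e)]
  [∀ e, FiniteDimensional F (S e)] {q : ∀ e, B →ₗ[F] S e}

lemma mem_induced_constraint {x : G.vertexSet} {k : (I → F) × (∀ e, S e)} :
    (induced ω f S q).toLocal x k ∈ (induced ω f S q).constraint x ↔
      ∃ b, (∀ i, ω i = x → f b i = k.1 i) ∧ ∀ e : G.edgeSet, G.Inc e.1 x.1 → q e b = k.2 e := by
  refine exists_congr fun b => ?_
  exact toLocal_eq_iff (Γ := induced ω f S q) (k := (f b, fun e => q e b))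

lemma mem_induced_fullBehavior (b : B) :
    ((f b, fun e => q e b) : (I → F) × (∀ e, S e)) ∈ (induced ω f S q).fullBehavior :=
  mem_fullBehavior.2 fun _ => mem_induced_constraint.2 ⟨b, fun _ _ => rfl, fun _ _ => rfl⟩

/-- Essentiality is automatic, since the local codes are images of `B` and each element of `B` gives
a global configuration. Gluing is needed only on symbols, to rule out codewords outside the range of
`f`. -/
lemma induced_isRealization (hq : ∀ e, Function.Surjective (q e))
    (glue : ∀ b : G.vertexSet → B,
      (∀ (e : G.edgeSet) x y, G.Inc e.1 x.1 → G.Inc e.1 y.1 → q e (b x) = q e (b y)) →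
        ∃ c, ∀ i, f (b (ω i)) i = f c i) :
    (induced ω f S q).IsRealization (LinearMap.range f) := by
  refine ⟨⟨fun x => le_antisymm ?_ ?_, fun e => ?_⟩, le_antisymm ?_ ?_⟩
  · rintro _ ⟨k, hk, rfl⟩
    exact mem_fullBehavior.1 hk x
  · rintro _ ⟨b, rfl⟩
    exact ⟨_, mem_induced_fullBehavior b, rfl⟩
  · rw [eq_top_iff]
    rintro s -
    obtain ⟨b, rfl⟩ := hq e s
    exact ⟨_, mem_induced_fullBehavior b, rfl⟩
  · rintro _ ⟨k, hk, rfl⟩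
    choose b hbf hbq using fun x => mem_induced_constraint.1 (mem_fullBehavior.1 hk x)
    obtain ⟨c, hc⟩ := glue b fun e x y hx hy => by rw [hbq x e hx, hbq y e hy]
    refine ⟨c, funext fun i => ?_⟩
    rw [← hc, hbf _ i rfl]
    rfl
  · rintro _ ⟨b, rfl⟩
    exact ⟨_, mem_induced_fullBehavior b, rfl⟩

lemma finrank_induced_constraint_le [FiniteDimensional F B] {x : G.vertexSet} {K : Submodule F B}
    (hf : ∀ b ∈ K, ∀ i, ω i = x → f b i = 0)
    (hq : ∀ b ∈ K, ∀ e : G.edgeSet, G.Inc e.1 x.1 → q e b = 0) :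
    Module.finrank F ((induced ω f S q).constraint x) ≤ Module.finrank F (B ⧸ K) := by
  let g := (LinearMap.pi fun i : {i : I // ω i = x} => LinearMap.proj i.1 ∘ₗ f).prod
    (LinearMap.pi fun e : {e : G.edgeSet // G.Inc e.1 x.1} => q e.1)
  have hg : K ≤ LinearMap.ker g := by
    intro b hb
    refine Prod.ext (funext fun i => hf b hb i.1 i.2) (funext fun e => hq b hb e.1 e.2)
  have h := LinearMap.finrank_range_le (K.liftQ g hg)
  rwa [Submodule.range_liftQ] at h

end

end GraphicalModel

open GraphicalModel

/-- The repetition model: every code has a realization on every connected graph. -/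
lemma exists_isRealization [Finite I] (C : Submodule F (I → F)) (hG : IsConnected G)
    (ω : I → G.vertexSet) : ∃ Γ : GraphicalModel F G ω, Γ.IsRealization C := by
  refine ⟨induced ω C.subtype (fun _ => C) (fun _ => LinearMap.id), ?_⟩
  have h := induced_isRealization (ω := ω) (f := C.subtype) (S := fun _ => C)
    (q := fun _ => LinearMap.id) (fun _ => Function.surjective_id) ?_
  · rwa [Submodule.range_subtype] at h
  intro b hb
  have hconst : ∀ x y : V, Relation.ReflTransGen G.Adj x y →
      ∀ (hx : x ∈ G.vertexSet) (hy : y ∈ G.vertexSet), b ⟨x, hx⟩ = b ⟨y, hy⟩ := by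
    intro x y hxy
    induction hxy with
    | refl => exact fun _ _ => rfl
    | tail _ hyz ih =>
      intro hx hz
      obtain ⟨e, he⟩ := hyz
      exact (ih hx he.left_mem).trans
        (hb ⟨e, he.edge_mem⟩ ⟨_, he.left_mem⟩ ⟨_, hz⟩ he.inc_left he.inc_right)
  obtain ⟨x, hx⟩ := hG.1
  refine ⟨b ⟨x, hx⟩, fun i => ?_⟩
  rw [hconst x (ω i).1 (hG.2 _ hx _ (ω i).2) hx (ω i).2]

lemma finrank_constraint_le_complexity [Finite V] (Γ : GraphicalModel F G ω) (x : G.vertexSet) :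
    Module.finrank F (Γ.constraint x) ≤ Γ.complexity :=
  le_ciSup (f := fun x => Module.finrank F (Γ.constraint x)) (Set.finite_range _).bddAbove x

lemma exists_isRealization_complexity_eq [Finite I] (C : Submodule F (I → F))
    (hG : IsConnected G) :
    ∃ (ω : I → G.vertexSet) (Γ : GraphicalModel F G ω),
      Γ.IsRealization C ∧ graphWidth C G = Γ.complexity := by
  obtain ⟨x, hx⟩ := hG.1
  obtain ⟨ω, hω⟩ := Nat.sInf_mem (s := {k | ∃ ω : I → G.vertexSet, k = decompositionWidth C G ω})
    ⟨_, fun _ => ⟨x, hx⟩, rfl⟩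
  obtain ⟨Γ₀, hΓ₀⟩ := exists_isRealization C hG ω
  obtain ⟨Γ, hΓ, h⟩ := Nat.sInf_mem
    (s := {k | ∃ Γ : GraphicalModel F G ω, Γ.IsRealization C ∧ k = Γ.complexity})
    ⟨_, Γ₀, hΓ₀, rfl⟩
  exact ⟨ω, Γ, hΓ, hω.trans h⟩

lemma codePathwidth_le {C : Submodule F (I → F)} {n : ℕ} (hn : 2 ≤ n)
    {ω : I → (Graph.ofSimpleGraph (SimpleGraph.pathGraph n)).vertexSet}
    {Γ : GraphicalModel F (Graph.ofSimpleGraph (SimpleGraph.pathGraph n)) ω}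
    (hΓ : Γ.IsRealization C) : codePathwidth C ≤ Γ.complexity :=
  calc codePathwidth C
      ≤ graphWidth C (Graph.ofSimpleGraph (SimpleGraph.pathGraph n)) := Nat.sInf_le ⟨n, hn, rfl⟩
    _ ≤ decompositionWidth C _ ω := Nat.sInf_le ⟨ω, rfl⟩
    _ ≤ Γ.complexity := Nat.sInf_le ⟨Γ, hΓ, rfl⟩

/-- The quotient of `B` by `M`, realized on a coordinate space in a prescribed universe. -/
lemma exists_surjective_ker_eq {B : Type w} [AddCommGroup B] [Module F B] [FiniteDimensional F B]
    (M : Submodule F B) :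
    ∃ q : B →ₗ[F] ULift.{v} (Fin (Module.finrank F (B ⧸ M)) → F),
      Function.Surjective q ∧ LinearMap.ker q = M := by
  let e : (B ⧸ M) ≃ₗ[F] ULift.{v} (Fin (Module.finrank F (B ⧸ M)) → F) :=
    (Module.finBasis F (B ⧸ M)).equivFun.trans ULift.moduleEquiv.symm
  refine ⟨e.toLinearMap ∘ₗ M.mkQ, e.surjective.comp M.mkQ_surjective, ?_⟩
  rw [LinearMap.ker_comp, LinearEquiv.ker, ← LinearMap.ker, Submodule.ker_mkQ]

lemma inc_ofSimpleGraph {W : Type*} {T : SimpleGraph W} {e : Sym2 W} {x : W} :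
    (Graph.ofSimpleGraph T).Inc e x ↔ e ∈ T.edgeSet ∧ x ∈ e := by
  constructor
  · rintro ⟨y, rfl, h⟩
    exact ⟨h, Sym2.mem_mk_left _ _⟩
  · rintro ⟨h, y, rfl⟩
    exact ⟨y, rfl, h⟩

/-- Given, for each vertex `x` of a simple graph, a subspace `K x` of a space `B` of configurations
(those that vanish at `x`), the quotients by `K x ⊔ K y` serve as state spaces of the edges. -/
lemma exists_isRealization_of_glue {B : Type w} [AddCommGroup B] [Module F B]
    [FiniteDimensional F B] (f : B →ₗ[F] (I → F)) {W : Type*} (T : SimpleGraph W)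
    (K : W → Submodule F B) (ω : I → (Graph.ofSimpleGraph T).vertexSet)
    (hω : ∀ i, ∀ b ∈ K (ω i).1, f b i = 0)
    (glue : ∀ b : W → B, (∀ x y, T.Adj x y → b x - b y ∈ K x ⊔ K y) →
      ∃ c, ∀ x, c - b x ∈ K x) :
    ∃ Γ : GraphicalModel F (Graph.ofSimpleGraph T) ω, Γ.IsRealization (LinearMap.range f) ∧
      ∀ x, Module.finrank F (Γ.constraint x) ≤ Module.finrank F (B ⧸ K x.1) := by
  choose q hq hker using fun e : (Graph.ofSimpleGraph T).edgeSet =>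
    exists_surjective_ker_eq.{u, v, w} (F := F) (⨆ x ∈ e.1, K x)
  refine ⟨induced ω f _ q, induced_isRealization hq fun b hb => ?_,
    fun x => finrank_induced_constraint_le ?_ ?_⟩
  · obtain ⟨c, hc⟩ := glue (fun x => b ⟨x, Set.mem_univ x⟩) fun x y hxy => by
      have he : s(x, y) ∈ T.edgeSet := hxy
      have h := hb ⟨s(x, y), he⟩ ⟨x, Set.mem_univ x⟩ ⟨y, Set.mem_univ y⟩
        (inc_ofSimpleGraph.2 ⟨he, Sym2.mem_mk_left _ _⟩)
        (inc_ofSimpleGraph.2 ⟨he, Sym2.mem_mk_right _ _⟩)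
      rw [← sub_eq_zero, ← map_sub, ← LinearMap.mem_ker, hker] at h
      have hle : ⨆ z ∈ s(x, y), K z ≤ K x ⊔ K y := iSup₂_le fun z hz => by
        rcases Sym2.mem_iff.1 hz with rfl | rfl
        exacts [le_sup_left, le_sup_right]
      exact hle h
    refine ⟨c, fun i => ?_⟩
    have h := hω i _ (hc (ω i).1)
    rw [map_sub, Pi.sub_apply, sub_eq_zero] at h
    exact h.symm
  · rintro b hb i rfl
    exact hω i b hb
  · intro b hb e he
    rw [← LinearMap.mem_ker, hker]
    have hle : K x.1 ≤ ⨆ z ∈ e.1, K z := le_iSup₂_of_le x.1 (inc_ofSimpleGraph.1 he).2 le_rfl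
    exact hle hb

namespace GraphicalModel

/-- If a set `S` of vertices separates `L` from the rest of the graph, then a configuration that
vanishes at `S` may be cut off outside `L`. -/
lemma exists_cutoff (Γ : GraphicalModel F G ω) {S L : Set V} (hL : neighbors G L ⊆ L ∪ S)
    {k : (I → F) × (∀ e, Γ.State e)} (hk : k ∈ Γ.fullBehavior)
    (hS : ∀ x : G.vertexSet, x.1 ∈ S → Γ.toLocal x k = 0) :
    ∃ l ∈ Γ.fullBehavior, (∀ x : G.vertexSet, x.1 ∈ L → Γ.toLocal x l = Γ.toLocal x k) ∧
      ∀ x : G.vertexSet, x.1 ∉ L → Γ.toLocal x l = 0 := by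
  classical
  let l : (I → F) × (∀ e, Γ.State e) :=
    (fun i => if (ω i).1 ∈ L then k.1 i else 0,
      fun e => if ∃ u ∈ L, G.Inc e.1 u then k.2 e else 0)
  have hin : ∀ x : G.vertexSet, x.1 ∈ L → Γ.toLocal x l = Γ.toLocal x k := by
    intro x hx
    refine toLocal_eq_iff.2 ⟨?_, fun e he => if_pos ⟨x.1, hx, he⟩⟩
    rintro i rfl
    exact if_pos hx
  have hout : ∀ x : G.vertexSet, x.1 ∉ L → Γ.toLocal x l = 0 := by
    intro x hx
    rw [← map_zero (Γ.toLocal x)]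
    refine toLocal_eq_iff.2 ⟨?_, fun e he => ?_⟩
    · rintro i rfl
      exact if_neg hx
    · by_cases h : ∃ u ∈ L, G.Inc e.1 u
      swap
      · exact if_neg h
      refine (if_pos h).trans ?_
      obtain ⟨u, hu, y, hy⟩ := h
      obtain rfl : x.1 = y := he.eq_of_isLink_of_ne_left hy fun hxu => hx (hxu ▸ hu)
      have hxS := (hL ⟨u, hu, e.1, hy⟩).resolve_left hx
      have h0 := hS x hxS
      rw [← map_zero (Γ.toLocal x)] at h0
      exact (toLocal_eq_iff.1 h0).2 e he
  refine ⟨l, mem_fullBehavior.2 fun x => ?_, hin, hout⟩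
  by_cases hx : x.1 ∈ L
  · rw [hin x hx]
    exact mem_fullBehavior.1 hk x
  · rw [hout x hx]
    exact Submodule.zero_mem _

/-- The configurations in the full behavior that vanish locally at all vertices in `S`. -/
def vanishing (Γ : GraphicalModel F G ω) (S : Set V) : Submodule F Γ.fullBehavior :=
  ⨅ x : {x : G.vertexSet // x.1 ∈ S}, LinearMap.ker (Γ.toLocal x.1 ∘ₗ Γ.fullBehavior.subtype)

lemma mem_vanishing {Γ : GraphicalModel F G ω} {S : Set V} {b : Γ.fullBehavior} :
    b ∈ Γ.vanishing S ↔ ∀ x : G.vertexSet, x.1 ∈ S → Γ.toLocal x b.1 = 0 := by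
  simp [vanishing]

lemma finrank_quotient_vanishing_le [Finite I] [Finite V] [Finite E] (Γ : GraphicalModel F G ω)
    (S : Set V) :
    Module.finrank F (Γ.fullBehavior ⧸ Γ.vanishing S) ≤ S.ncard * Γ.complexity := by
  classical
  have := Fintype.ofFinite {x : G.vertexSet // x.1 ∈ S}
  let g : Γ.fullBehavior →ₗ[F] ∀ x : {x : G.vertexSet // x.1 ∈ S}, Γ.constraint x.1 :=
    LinearMap.pi fun x => (Γ.toLocal x.1 ∘ₗ Γ.fullBehavior.subtype).codRestrict _
      fun b => mem_fullBehavior.1 b.2 x.1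
  have hg : LinearMap.ker g = Γ.vanishing S := by
    simp only [g, vanishing, LinearMap.ker_pi]
    exact iInf_congr fun x => LinearMap.ker_codRestrict _ _ _
  rw [← hg, LinearEquiv.finrank_eq g.quotKerEquivRange]
  calc Module.finrank F (LinearMap.range g)
      ≤ Module.finrank F (∀ x : {x : G.vertexSet // x.1 ∈ S}, Γ.constraint x.1) :=
        Submodule.finrank_le _
    _ = ∑ x : {x : G.vertexSet // x.1 ∈ S}, Module.finrank F (Γ.constraint x.1) :=
        Module.finrank_pi_fintype F
    _ ≤ ∑ _x : {x : G.vertexSet // x.1 ∈ S}, Γ.complexity :=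
        Finset.sum_le_sum fun x _ => finrank_constraint_le_complexity Γ x.1
    _ = Fintype.card {x : G.vertexSet // x.1 ∈ S} * Γ.complexity := by simp
    _ ≤ S.ncard * Γ.complexity := by
        refine Nat.mul_le_mul_right _ ?_
        rw [← Nat.card_eq_fintype_card, ← Nat.card_coe_set_eq]
        exact Nat.card_le_card_of_injective (fun x => (⟨x.1.1, x.2⟩ : S))
          fun x y h => Subtype.ext (Subtype.ext (congrArg (fun s : S => s.1) h))

end GraphicalModel

/-- A realization on `G` and a vertex-cut path of `G` yield a realization on a path. -/
lemma codePathwidth_le_mul [Finite I] [Finite V] [Finite E] {C : Submodule F (I → F)}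
    {Γ : GraphicalModel F G ω} (hΓ : Γ.IsRealization C) {n : ℕ} (hn : 2 ≤ n) {β : Fin n → Set V}
    (hβ : IsVertexCutTree G (SimpleGraph.pathGraph n) β) :
    codePathwidth C ≤ maxBag β * Γ.complexity := by
  have hbag : ∀ i, ∃ z, (ω i).1 ∈ β z := fun i =>
    Set.mem_iUnion.1 (hβ.cover.symm ▸ (ω i).2)
  choose τ hτ using hbag
  let f := LinearMap.fst F (I → F) (∀ e, Γ.State e) ∘ₗ Γ.fullBehavior.subtype
  have hf : ∀ i, ∀ b ∈ Γ.vanishing (β (τ i)), f b i = 0 := by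
    intro i b hb
    have h := mem_vanishing.1 hb (ω i) (hτ i)
    rw [← map_zero (Γ.toLocal (ω i))] at h
    exact (toLocal_eq_iff.1 h).1 i rfl
  have glue : ∀ b : Fin n → Γ.fullBehavior,
      (∀ x y, (SimpleGraph.pathGraph n).Adj x y →
        b x - b y ∈ Γ.vanishing (β x) ⊔ Γ.vanishing (β y)) →
      ∃ c, ∀ x, c - b x ∈ Γ.vanishing (β x) := by
    intro b hb
    refine exists_glue_of_split _ (fun z k hk => ?_) b fun x y hxy =>
      hb x y (SimpleGraph.pathGraph_adj.2 (Or.inl hxy))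
    obtain ⟨l, hlB, hin, hout⟩ :=
      Γ.exists_cutoff (hβ.neighbors_left_subset z) k.2 (mem_vanishing.1 hk)
    refine ⟨⟨l, hlB⟩, k - ⟨l, hlB⟩, add_sub_cancel _ _, fun y hzy => ?_, fun y hyz => ?_⟩
    · refine mem_vanishing.2 fun x hx => hout x fun hxL => hxL.2 ?_
      have h1 := hxL.1
      simp only [Set.mem_iUnion] at h1
      obtain ⟨y', hy', hxy'⟩ := h1
      exact hβ.inter_subset_of_between hy' hzy ⟨hxy', hx⟩
    · refine mem_vanishing.2 fun x hx => ?_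
      change Γ.toLocal x (k.1 - l) = 0
      rw [map_sub]
      by_cases hxz : x.1 ∈ β z
      · rw [mem_vanishing.1 hk x hxz, hout x fun h => h.2 hxz, sub_zero]
      · have hyz' : y < z := lt_of_le_of_ne hyz fun h => hxz (h ▸ hx)
        rw [hin x ⟨Set.mem_biUnion (show y ∈ {y | y < z} from hyz') hx, hxz⟩, sub_self]
  obtain ⟨Δ, hΔ, hdim⟩ := exists_isRealization_of_glue f (SimpleGraph.pathGraph n)
    (fun z => Γ.vanishing (β z)) (fun i => ⟨τ i, Set.mem_univ _⟩) hf glue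
  rw [LinearMap.range_comp, Submodule.range_subtype, hΓ.2] at hΔ
  refine (codePathwidth_le hn hΔ).trans (ciSup_le' fun x => ?_)
  exact ((hdim x).trans (Γ.finrank_quotient_vanishing_le _)).trans
    (Nat.mul_le_mul_right _ (ncard_le_maxBag β x.1))

lemma codePathwidth_le_vcPathwidth_mul_graphWidth [Finite I] [Finite V] [Finite E]
    (C : Submodule F (I → F)) (hG : IsConnected G) :
    codePathwidth C ≤ vcPathwidth G * graphWidth C G := by
  obtain ⟨ω, Γ, hΓ, hk⟩ := exists_isRealization_complexity_eq C hG
  obtain ⟨n, hn, β, hβ, hw⟩ := exists_vertexCutPath G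
  rw [hk, hw]
  exact codePathwidth_le_mul hΓ hn hβ

end Models

end CodesOnGraphs

theorem mainTheorem5 {F : Type*} [Field F] [Finite F] {I : Type*} [Finite I]
    (C : Submodule F (I → F))
    {V E : Type*} [Finite V] [Finite E] (G : Graph V E) (hG : CodesOnGraphs.IsConnected G) :
    0 < CodesOnGraphs.vcPathwidth G ∧
    (CodesOnGraphs.codePathwidth C : ℝ) / (CodesOnGraphs.vcPathwidth G : ℝ) ≤
      (CodesOnGraphs.graphWidth C G : ℝ) ∧
    (CodesOnGraphs.codePathwidth C : ℝ) / ((CodesOnGraphs.graphPathwidth G : ℝ) + 1) ≤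
      (CodesOnGraphs.codePathwidth C : ℝ) / (CodesOnGraphs.vcPathwidth G : ℝ) := by
  have hpos := CodesOnGraphs.vcPathwidth_pos hG
  have hpos' : (0 : ℝ) < CodesOnGraphs.vcPathwidth G := Nat.cast_pos.2 hpos
  refine ⟨hpos, ?_, ?_⟩
  · rw [div_le_iff₀' hpos']
    exact_mod_cast CodesOnGraphs.codePathwidth_le_vcPathwidth_mul_graphWidth C hG
  · refine div_le_div_of_nonneg_left (Nat.cast_nonneg _) hpos' ?_
    exact_mod_cast CodesOnGraphs.vcPathwidth_le_graphPathwidth_add_one hG
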